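/- Let $h:\mathbb{R}\to\mathbb{R}$ be $1$-periodic, of class $C^{1,1}$ (continuously differentiable with Lipschitz derivative), with $h>0$, and let $\Omega=\{(x,y): 0\le x\le 1,\ 0<y<h(x)\}$, periodic in $x$ (the points $(0,y)$ and $(1,y)$ are identified), with lower boundary $\Gamma_0=\{y=0\}$ and upper boundary $\Gamma_1=\{y=h(x)\}$. Let $H^2(\Omega)$ be the completion, in the usual Sobolev norm, of the $x$-periodic functions that are $C^2$ up to $\Gamma_0$ and $\Gamma_1$, and let $$\Psi=\left\{\psi\in H^2(\Omega)\ :\ \psi|_{\Gamma_0}=0,\ \ \psi_y|_{\Gamma_0}=0,\ \ \psi|_{\Gamma_1}=\text{const},\ \ \psi_y|_{\Gamma_1}=0\right\}$$ (boundary values in the trace sense). For $\varepsilon>0$ and $\psi,\phi\in H^2(\Omega)$ put $$a_\varepsilon(\psi,\phi)=\int_\Omega \psi_{yy}\phi_{yy}+2\varepsilon^2\psi_{xy}\phi_{xy}+\varepsilon^4\psi_{xx}\phi_{xx}\,dA,$$ $$\|\psi\|_{2,\varepsilon}^2=\int_\Omega\psi^2\,dA+\int_\Omega\left(\psi_y^2+(\varepsilon\psi_x)^2\right)dA+a_\varepsilon(\psi,\psi).$$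 Then the bilinear form $a_\varepsilon$ is coercive on $\Psi$, uniformly in $\varepsilon$: there is a constant $\alpha>0$, independent of $\varepsilon$ and $\psi$, such that $$\alpha\,\|\psi\|_{2,\varepsilon}^2\le a_\varepsilon(\psi,\psi)\qquad\text{for all }\varepsilon>0,\ \psi\in\Psi.$$ Moreover, if $h(x)\le 1$ for all $x$, this holds with $\alpha=\tfrac{12}{19}$, that is, $$\tfrac{12}{19}\,\|\psi\|_{2,\varepsilon}^2\le a_\varepsilon(\psi,\psi)\qquad\text{for all }\varepsilon>0,\ \psi\in\Psi.$$ -/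

import Mathlib

open MeasureTheory

noncomputable section

namespace Lubrication

/-- `C^{1,1}(T)`, `T` the periodic unit interval: continuously differentiable functions of period
one with Lipschitz continuous derivative. -/
def IsC11Periodic (h : ℝ → ℝ) : Prop :=
  (∀ x, h (x + 1) = h x) ∧ ContDiff ℝ 1 h ∧ ∃ K : NNReal, LipschitzWith K (deriv h)

/-- One period `{(x, y) : 0 ≤ x ≤ 1, 0 < y < h x}` of the fluid domain. -/
def Omega (h : ℝ → ℝ) : Set (ℝ × ℝ) :=
  {p | 0 ≤ p.1 ∧ p.1 ≤ 1 ∧ 0 < p.2 ∧ p.2 < h p.1}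

/-- The area measure `dA` on the domain. -/
abbrev area (h : ℝ → ℝ) : Measure (ℝ × ℝ) := volume.restrict (Omega h)

/-- Real `L²` of the domain. -/
abbrev L2Omega (h : ℝ → ℝ) := Lp ℝ 2 (area h)

/-- `L²` of either boundary curve, parametrized by `x ∈ [0, 1]`. -/
abbrev L2Boundary := Lp ℝ 2 ((volume : Measure ℝ).restrict (Set.Icc 0 1))

/-- `C²` functions up to the boundary of the periodic domain: restrictions of `C²` functions on the
plane that have period one in `x`. -/
def IsC2Periodic (φ : ℝ × ℝ → ℝ) : Prop :=
  ContDiff ℝ 2 φ ∧ ∀ x y, φ (x + 1, y) = φ (x, y)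

/-- Classical partial derivative `∂φ/∂x`. -/
def dx (φ : ℝ × ℝ → ℝ) (p : ℝ × ℝ) : ℝ := deriv (fun t => φ (t, p.2)) p.1

/-- Classical partial derivative `∂φ/∂y`. -/
def dy (φ : ℝ × ℝ → ℝ) (p : ℝ × ℝ) : ℝ := deriv (fun t => φ (p.1, t)) p.2

/-- Labels for the partial derivatives of order at most two (`o` is the function itself). -/
inductive D2 : Type
  | o | x | y | xx | xy | yy

/-- The classical partial derivative with the given label. -/
def partialD (φ : ℝ × ℝ → ℝ) : D2 → ℝ × ℝ → ℝ
  | .o => φ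
  | .x => dx φ
  | .y => dy φ
  | .xx => dx (dx φ)
  | .xy => dx (dy φ)
  | .yy => dy (dy φ)

/-- Families `(ψ, ψ_x, ψ_y, ψ_xx, ψ_xy, ψ_yy)` of square integrable functions. -/
abbrev Jet (h : ℝ → ℝ) := D2 → L2Omega h

/-- `J` is the family of classical derivatives of `φ`, restricted to the domain. -/
def IsJetOf (h : ℝ → ℝ) (J : Jet h) (φ : ℝ × ℝ → ℝ) : Prop :=
  ∀ i, (J i : ℝ × ℝ → ℝ) =ᵐ[area h] partialD φ i

/-- `H²` of the periodic domain, the completion of the periodic `C²` functions in the Sobolev norm,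
realized as the closure of `φ ↦ (φ, φ_x, φ_y, φ_xx, φ_xy, φ_yy)` in the sixfold product of `L²`.
The component `ψ .xy` of an element `ψ` is its weak derivative `ψ_xy`, and so on. -/
def H2 (h : ℝ → ℝ) : Set (Jet h) :=
  closure {J | ∃ φ, IsC2Periodic φ ∧ IsJetOf h J φ}

/-- `g` is the trace of `ψ` for the boundary operator `τ`, which is given on classical functions:
the pair `(ψ, g)` is a limit, in `H² × L²`, of pairs `(φ, τ φ)` with `φ` periodic and `C²`. -/
def HasTrace (h : ℝ → ℝ) (τ : (ℝ × ℝ → ℝ) → ℝ → ℝ) (ψ : H2 h) (g : L2Boundary) : Prop :=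
  ((ψ : Jet h), g) ∈ closure {q : Jet h × L2Boundary |
    ∃ φ, IsC2Periodic φ ∧ IsJetOf h q.1 φ ∧
      (q.2 : ℝ → ℝ) =ᵐ[volume.restrict (Set.Icc 0 1)] τ φ}

/-- Restriction to the lower boundary `y = 0`. -/
def onBottom (φ : ℝ × ℝ → ℝ) (x : ℝ) : ℝ := φ (x, 0)

/-- Restriction to the upper boundary `y = h x`. -/
def onTop (h : ℝ → ℝ) (φ : ℝ × ℝ → ℝ) (x : ℝ) : ℝ := φ (x, h x)

/-- The space of stream functions: those `ψ ∈ H²` with `ψ = ψ_y = 0` on the lower boundary,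
`ψ` constant and `ψ_y = 0` on the upper boundary, in the sense of traces. -/
def Psi (h : ℝ → ℝ) : Set (H2 h) :=
  {ψ | HasTrace h onBottom ψ 0 ∧ HasTrace h (fun φ => onBottom (dy φ)) ψ 0 ∧
    (∃ (c : ℝ) (g : L2Boundary), ((g : ℝ → ℝ) =ᵐ[volume.restrict (Set.Icc 0 1)] fun _ => c) ∧
      HasTrace h (onTop h) ψ g) ∧
    HasTrace h (fun φ => onTop h (dy φ)) ψ 0}

/-- The weak derivative of `ψ ∈ H²` with label `i`, as a function on the domain. -/
def wD {h : ℝ → ℝ} (ψ : H2 h) (i : D2) : ℝ × ℝ → ℝ := (ψ : Jet h) i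

/-- The bilinear form
`a_ε(ψ, φ) = ∫_Ω ψ_yy φ_yy + 2 ε² ψ_xy φ_xy + ε⁴ ψ_xx φ_xx dA`. -/
def aForm {h : ℝ → ℝ} (ε : ℝ) (ψ φ : H2 h) : ℝ :=
  ∫ p, (wD ψ .yy p * wD φ .yy p + 2 * ε ^ 2 * (wD ψ .xy p * wD φ .xy p)
    + ε ^ 4 * (wD ψ .xx p * wD φ .xx p)) ∂(area h)

/-- `‖ψ‖₀² = ∫_Ω ψ² dA`. -/
def norm0Sq {h : ℝ → ℝ} (ψ : H2 h) : ℝ := ∫ p, wD ψ .o p ^ 2 ∂(area h)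

/-- `|ψ|²_{1,ε} = ∫_Ω ψ_y² + (ε ψ_x)² dA`. -/
def seminorm1Sq {h : ℝ → ℝ} (ε : ℝ) (ψ : H2 h) : ℝ :=
  ∫ p, (wD ψ .y p ^ 2 + (ε * wD ψ .x p) ^ 2) ∂(area h)

/-- `|ψ|²_{2,ε} = a_ε(ψ, ψ)`. -/
def seminorm2Sq {h : ℝ → ℝ} (ε : ℝ) (ψ : H2 h) : ℝ := aForm ε ψ ψ

/-- The weighted norm `‖ψ‖_{2,ε}`. -/
def weightedNorm2 {h : ℝ → ℝ} (ε : ℝ) (ψ : H2 h) : ℝ :=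
  Real.sqrt (norm0Sq ψ + seminorm1Sq ε ψ + seminorm2Sq ε ψ)

end Lubrication

end

namespace Lubrication

/-! Everything rests on `ψ` and `ψ_y` vanishing on the lower boundary. On a vertical section of
height at most `H`, Taylor's formula at `y = 0` and Cauchy–Schwarz give `∫ψ² ≤ H⁴/12 ∫ψ_yy²` and
`∫ψ_y² ≤ H²/2 ∫ψ_yy²`. Moreover `ψ = 0` on the flat curve `y = 0` forces its tangential derivative
`ψ_x` to vanish there, so `∫ψ_x² ≤ H²/2 ∫ψ_xy²`. Multiplied by `ε²`, the right side is controlled by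
a term of `a_ε` with the same weight, which is why the constant `1 + H²/2 + H⁴/12` does not depend
on `ε`.

The work lies in the weak setting. The inequalities are proved for smooth approximants with their
boundary values subtracted (`poincare_bottom`, `poincare_bottom_second`) and passed to the limit by
`integral_sq_le_of_tendsto`, provided the boundary values tend to zero in `L²`. The trace inequality
`trace_bottom_le` makes that vanishing independent of the approximating sequence, so one sequence
serves both `ψ` and `ψ_y`. For `ψ_x` it makes the traces Cauchy, and integration by parts over a
period identifies their limit as zero (`tendsto_integral_sq_deriv_zero`). -/

/-! ### One-dimensional inequalities -/

theorem sq_integral_mul_le {u v : ℝ → ℝ} (hu : Continuous u) (hv : Continuous v) {a b : ℝ}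
    (hab : a ≤ b) :
    (∫ t in a..b, u t * v t) ^ 2 ≤ (∫ t in a..b, u t ^ 2) * ∫ t in a..b, v t ^ 2 := by
  have key : ∀ s : ℝ, 0 ≤ (∫ t in a..b, u t ^ 2) * (s * s)
      + (2 * ∫ t in a..b, u t * v t) * s + ∫ t in a..b, v t ^ 2 := by
    intro s
    have h0 : 0 ≤ ∫ t in a..b, (s * u t + v t) ^ 2 :=
      intervalIntegral.integral_nonneg hab fun t _ => sq_nonneg _
    have h1 : ∫ t in a..b, (s * u t + v t) ^ 2 =
        ∫ t in a..b, ((s * s) * u t ^ 2 + (2 * s) * (u t * v t) + v t ^ 2) := by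
      congr 1; ext t; ring
    rw [h1, intervalIntegral.integral_add, intervalIntegral.integral_add,
      intervalIntegral.integral_const_mul, intervalIntegral.integral_const_mul] at h0
    · linarith
    all_goals exact Continuous.intervalIntegrable (by fun_prop) _ _
  have := discrim_le_zero key
  rw [discrim] at this
  linarith

theorem integral_sq_mono_right {v : ℝ → ℝ} (hv : Continuous v) {y L : ℝ} (hy : 0 ≤ y)
    (hyL : y ≤ L) : ∫ t in (0 : ℝ)..y, v t ^ 2 ≤ ∫ t in (0 : ℝ)..L, v t ^ 2 :=
  intervalIntegral.integral_mono_interval le_rfl hy hyL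
    (Filter.Eventually.of_forall fun t => sq_nonneg (v t))
    (Continuous.intervalIntegrable (by fun_prop) _ _)

theorem sq_sub_zero_le {f f' : ℝ → ℝ} (hf : ∀ t, HasDerivAt f (f' t) t) (hf' : Continuous f')
    {y L : ℝ} (hy : 0 ≤ y) (hyL : y ≤ L) :
    (f y - f 0) ^ 2 ≤ y * ∫ t in (0 : ℝ)..L, f' t ^ 2 := by
  have h1 := intervalIntegral.integral_eq_sub_of_hasDerivAt (a := 0) (b := y)
    (fun t _ => hf t) (hf'.intervalIntegrable _ _)
  have h2 := sq_integral_mul_le (u := fun _ => 1) continuous_const hf' hy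
  simp only [one_mul, one_pow, intervalIntegral.integral_const, smul_eq_mul, mul_one,
    sub_zero] at h2
  rw [h1] at h2
  exact h2.trans (mul_le_mul_of_nonneg_left (integral_sq_mono_right hf' hy hyL) hy)

/-- Cauchy–Schwarz applied to the Taylor remainder `∫₀^y (y - t) f''(t) dt`. The remainder formula
comes from the primitive `(y - t) f'(t) + f(t)` of the integrand, and `y³/3` is `∫₀^y (y - t)² dt`.
-/
theorem sq_sub_taylor_le {f f' f'' : ℝ → ℝ} (hf : ∀ t, HasDerivAt f (f' t) t)
    (hf' : ∀ t, HasDerivAt f' (f'' t) t) (hf'' : Continuous f'')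
    {y L : ℝ} (hy : 0 ≤ y) (hyL : y ≤ L) :
    (f y - (f 0 + y * f' 0)) ^ 2 ≤ y ^ 3 / 3 * ∫ t in (0 : ℝ)..L, f'' t ^ 2 := by
  have h1 := intervalIntegral.integral_eq_sub_of_hasDerivAt (a := 0) (b := y)
    (f := fun t => (y - t) * f' t + f t) (f' := fun t => (y - t) * f'' t)
    (fun t _ => by
      have h := ((((hasDerivAt_const t y).sub (hasDerivAt_id t)).mul (hf' t)).add (hf t))
      refine h.congr_deriv ?_
      simp) (Continuous.intervalIntegrable (by fun_prop) _ _)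
  have h2 := sq_integral_mul_le (u := fun t => y - t) (by fun_prop) hf'' hy
  have h3 : ∫ t in (0 : ℝ)..y, (y - t) ^ 2 = y ^ 3 / 3 := by
    rw [intervalIntegral.integral_comp_sub_left (fun t => t ^ 2) y, integral_pow]
    norm_num
  rw [h1, h3] at h2
  have h4 : (y - y) * f' y + f y - ((y - 0) * f' 0 + f 0) = f y - (f 0 + y * f' 0) := by ring
  rw [h4] at h2
  exact h2.trans (mul_le_mul_of_nonneg_left (integral_sq_mono_right hf'' hy hyL) (by positivity))

theorem integral_sq_sub_zero_le {f f' : ℝ → ℝ} (hf : ∀ t, HasDerivAt f (f' t) t)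
    (hf' : Continuous f') {L : ℝ} (hL : 0 ≤ L) :
    ∫ y in (0 : ℝ)..L, (f y - f 0) ^ 2 ≤ L ^ 2 / 2 * ∫ t in (0 : ℝ)..L, f' t ^ 2 := by
  have hc : Continuous f := continuous_iff_continuousAt.2 fun t => (hf t).continuousAt
  have h := intervalIntegral.integral_mono_on hL
    (Continuous.intervalIntegrable (μ := volume) (by fun_prop) _ _)
    (Continuous.intervalIntegrable (μ := volume) (by fun_prop) _ _)
    fun y hy => sq_sub_zero_le hf hf' hy.1 hy.2
  rw [intervalIntegral.integral_mul_const, integral_id] at h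
  simpa using h

theorem integral_sq_sub_taylor_le {f f' f'' : ℝ → ℝ} (hf : ∀ t, HasDerivAt f (f' t) t)
    (hf' : ∀ t, HasDerivAt f' (f'' t) t) (hf'' : Continuous f'') {L : ℝ} (hL : 0 ≤ L) :
    ∫ y in (0 : ℝ)..L, (f y - (f 0 + y * f' 0)) ^ 2 ≤
      L ^ 4 / 12 * ∫ t in (0 : ℝ)..L, f'' t ^ 2 := by
  have hc : Continuous f := continuous_iff_continuousAt.2 fun t => (hf t).continuousAt
  have h := intervalIntegral.integral_mono_on hL
    (Continuous.intervalIntegrable (μ := volume) (by fun_prop) _ _)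
    (Continuous.intervalIntegrable (μ := volume) (by fun_prop) _ _)
    fun y hy => sq_sub_taylor_le hf hf' hf'' hy.1 hy.2
  rw [intervalIntegral.integral_mul_const, intervalIntegral.integral_div, integral_pow] at h
  convert h using 2
  norm_num
  ring

/-- One-dimensional trace inequality. -/
theorem mul_sq_zero_le {f f' : ℝ → ℝ} (hf : ∀ t, HasDerivAt f (f' t) t)
    (hf' : Continuous f') {L : ℝ} (hL : 0 ≤ L) :
    L * f 0 ^ 2 ≤ 2 * (∫ t in (0 : ℝ)..L, f t ^ 2) + L ^ 2 * ∫ t in (0 : ℝ)..L, f' t ^ 2 := by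
  have hc : Continuous f := continuous_iff_continuousAt.2 fun t => (hf t).continuousAt
  have h := intervalIntegral.integral_mono_on hL
    (f := fun _ => f 0 ^ 2) (g := fun y => 2 * f y ^ 2 + 2 * (f y - f 0) ^ 2)
    (Continuous.intervalIntegrable (μ := volume) (by fun_prop) _ _)
    (Continuous.intervalIntegrable (μ := volume) (by fun_prop) _ _)
    fun y hy => by nlinarith [sq_nonneg (2 * f y - f 0)]
  rw [intervalIntegral.integral_add, intervalIntegral.integral_const_mul,
    intervalIntegral.integral_const_mul] at h
  · have := integral_sq_sub_zero_le hf hf' hL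
    simp only [intervalIntegral.integral_const, smul_eq_mul, sub_zero] at h
    linarith
  all_goals exact Continuous.intervalIntegrable (by fun_prop) _ _

/-- If `gₙ → 0` in `L²` and the derivatives `gₙ'` form a Cauchy sequence, then `gₙ' → 0`. -/
theorem tendsto_integral_sq_deriv_zero {g g' g'' : ℕ → ℝ → ℝ} {r : ℕ → ℝ}
    (hg : ∀ n t, HasDerivAt (g n) (g' n t) t) (hg' : ∀ n t, HasDerivAt (g' n) (g'' n t) t)
    (hg'' : ∀ n, Continuous (g'' n)) (hper : ∀ n, g n 1 = g n 0) (hper' : ∀ n, g' n 1 = g' n 0)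
    (hlim : Filter.Tendsto (fun n => ∫ t in (0 : ℝ)..1, g n t ^ 2) Filter.atTop (nhds 0))
    (hr : Filter.Tendsto r Filter.atTop (nhds 0))
    (hC : ∀ n m, ∫ t in (0 : ℝ)..1, (g' n t - g' m t) ^ 2 ≤ r n + r m) :
    Filter.Tendsto (fun n => ∫ t in (0 : ℝ)..1, g' n t ^ 2) Filter.atTop (nhds 0) := by
  have hc : ∀ n, Continuous (g n) :=
    fun n => continuous_iff_continuousAt.2 fun t => (hg n t).continuousAt
  have hc' : ∀ n, Continuous (g' n) :=
    fun n => continuous_iff_continuousAt.2 fun t => (hg' n t).continuousAt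
  refine squeeze_zero (fun n => intervalIntegral.integral_nonneg zero_le_one
    fun t _ => sq_nonneg _) (fun m => ?_) hr
  -- With `m` fixed, `g'_m² ≤ (g'_n - g'_m)² + 2 g'_n g'_m`. Integrating the product by parts moves
  -- the derivative onto `g'_m`, and periodicity removes the boundary terms. Since `g''_m` stays
  -- fixed as `n → ∞`, no uniform bound on second derivatives is needed, and `r m` remains in the
  -- limit.
  have hbound : ∀ n, ∫ t in (0 : ℝ)..1, g' m t ^ 2 ≤ r n + r m +
      2 * √((∫ t in (0 : ℝ)..1, g n t ^ 2) * ∫ t in (0 : ℝ)..1, g'' m t ^ 2) := by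
    intro n
    have hparts : ∫ t in (0 : ℝ)..1, g' n t * g' m t = -∫ t in (0 : ℝ)..1, g n t * g'' m t := by
      have := intervalIntegral.integral_deriv_mul_eq_sub (a := 0) (b := 1)
        (fun t _ => hg n t) (fun t _ => hg' m t) ((hc' n).intervalIntegrable _ _)
        ((hg'' m).intervalIntegrable _ _)
      rw [intervalIntegral.integral_add, hper, hper'] at this
      · linarith
      all_goals exact Continuous.intervalIntegrable (by fun_prop) _ _
    have hle : ∫ t in (0 : ℝ)..1, g' m t ^ 2 ≤ ∫ t in (0 : ℝ)..1,
        ((g' n t - g' m t) ^ 2 + 2 * (g' n t * g' m t)) :=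
      intervalIntegral.integral_mono_on zero_le_one
        (Continuous.intervalIntegrable (by fun_prop) _ _)
        (Continuous.intervalIntegrable (by fun_prop) _ _)
        fun t _ => by nlinarith [sq_nonneg (g' n t)]
    rw [intervalIntegral.integral_add (Continuous.intervalIntegrable (by fun_prop) _ _)
      (Continuous.intervalIntegrable (by fun_prop) _ _), intervalIntegral.integral_const_mul,
      hparts] at hle
    have hcs := Real.abs_le_sqrt (sq_integral_mul_le (hc n) (hg'' m) zero_le_one)
    have := neg_le_abs (∫ t in (0 : ℝ)..1, g n t * g'' m t)
    linarith [hC n m]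
  have hl : Filter.Tendsto (fun n => r n + r m +
      2 * √((∫ t in (0 : ℝ)..1, g n t ^ 2) * ∫ t in (0 : ℝ)..1, g'' m t ^ 2))
      Filter.atTop (nhds (r m)) := by
    have := (hr.add_const (r m)).add (((hlim.mul_const
      (∫ t in (0 : ℝ)..1, g'' m t ^ 2)).sqrt).const_mul 2)
    simpa using this
  exact ge_of_tendsto' hl hbound

/-! ### Classical derivatives -/

theorem hasDerivAt_dx {φ : ℝ × ℝ → ℝ} (hφ : Differentiable ℝ φ) (p : ℝ × ℝ) :
    HasDerivAt (fun t => φ (t, p.2)) (fderiv ℝ φ p (1, 0)) p.1 := by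
  have h : HasDerivAt (fun t : ℝ => (t, p.2)) (1, 0) p.1 :=
    (hasDerivAt_id p.1).prodMk (hasDerivAt_const _ _)
  exact (hφ p).hasFDerivAt.comp_hasDerivAt p.1 h

theorem hasDerivAt_dy {φ : ℝ × ℝ → ℝ} (hφ : Differentiable ℝ φ) (p : ℝ × ℝ) :
    HasDerivAt (fun t => φ (p.1, t)) (fderiv ℝ φ p (0, 1)) p.2 := by
  have h : HasDerivAt (fun t : ℝ => (p.1, t)) (0, 1) p.2 :=
    (hasDerivAt_const _ _).prodMk (hasDerivAt_id p.2)
  exact (hφ p).hasFDerivAt.comp_hasDerivAt p.2 h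

theorem dx_eq_fderiv {φ : ℝ × ℝ → ℝ} (hφ : Differentiable ℝ φ) :
    dx φ = fun p => fderiv ℝ φ p (1, 0) :=
  funext fun p => (hasDerivAt_dx hφ p).deriv

theorem dy_eq_fderiv {φ : ℝ × ℝ → ℝ} (hφ : Differentiable ℝ φ) :
    dy φ = fun p => fderiv ℝ φ p (0, 1) :=
  funext fun p => (hasDerivAt_dy hφ p).deriv

theorem contDiff_dx {φ : ℝ × ℝ → ℝ} {m n : WithTop ℕ∞} (hφ : ContDiff ℝ n φ) (hmn : m + 1 ≤ n) :
    ContDiff ℝ m (dx φ) := by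
  rw [dx_eq_fderiv (hφ.differentiable (by rintro rfl; simp at hmn))]
  exact (hφ.fderiv_right hmn).clm_apply contDiff_const

theorem contDiff_dy {φ : ℝ × ℝ → ℝ} {m n : WithTop ℕ∞} (hφ : ContDiff ℝ n φ) (hmn : m + 1 ≤ n) :
    ContDiff ℝ m (dy φ) := by
  rw [dy_eq_fderiv (hφ.differentiable (by rintro rfl; simp at hmn))]
  exact (hφ.fderiv_right hmn).clm_apply contDiff_const

theorem dy_dx_eq {φ : ℝ × ℝ → ℝ} (hφ : ContDiff ℝ 2 φ) : dy (dx φ) = dx (dy φ) := by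
  have hd : Differentiable ℝ φ := hφ.differentiable (by norm_num)
  have hx : Differentiable ℝ (dx φ) := (contDiff_dx (m := 1) hφ (by norm_num)).differentiable
    (by norm_num)
  have hy : Differentiable ℝ (dy φ) := (contDiff_dy (m := 1) hφ (by norm_num)).differentiable
    (by norm_num)
  have hd2 : Differentiable ℝ (fderiv ℝ φ) :=
    (hφ.fderiv_right (m := 1) (by norm_num)).differentiable (by norm_num)
  rw [dy_eq_fderiv hx, dx_eq_fderiv hy, dy_eq_fderiv hd, dx_eq_fderiv hd]
  funext p
  have hs : IsSymmSndFDerivAt ℝ φ p := hφ.contDiffAt.isSymmSndFDerivAt (by simp)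
  have e : ∀ v w : ℝ × ℝ, fderiv ℝ (fun q => fderiv ℝ φ q v) p w
      = fderiv ℝ (fderiv ℝ φ) p w v := fun v w => by
    rw [((hd2 p).hasFDerivAt.clm_apply (hasFDerivAt_const v p)).fderiv]
    simp
  rw [e, e]
  exact hs _ _

theorem IsC2Periodic.continuous_partialD {φ : ℝ × ℝ → ℝ} (hφ : IsC2Periodic φ) (i : D2) :
    Continuous (partialD φ i) := by
  have hx : ContDiff ℝ 1 (dx φ) := contDiff_dx hφ.1 (by norm_num)
  have hy : ContDiff ℝ 1 (dy φ) := contDiff_dy hφ.1 (by norm_num)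
  cases i
  · exact hφ.1.continuous
  · exact hx.continuous
  · exact hy.continuous
  · exact (contDiff_dx (m := 0) hx (by simp)).continuous
  · exact (contDiff_dx (m := 0) hy (by simp)).continuous
  · exact (contDiff_dy (m := 0) hy (by simp)).continuous

theorem hasDerivAt_dy' {φ : ℝ × ℝ → ℝ} (hφ : Differentiable ℝ φ) (x y : ℝ) :
    HasDerivAt (fun t => φ (x, t)) (dy φ (x, y)) y := by
  rw [dy_eq_fderiv hφ]; exact hasDerivAt_dy hφ (x, y)

theorem hasDerivAt_dx' {φ : ℝ × ℝ → ℝ} (hφ : Differentiable ℝ φ) (x y : ℝ) :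
    HasDerivAt (fun t => φ (t, y)) (dx φ (x, y)) x := by
  rw [dx_eq_fderiv hφ]; exact hasDerivAt_dx hφ (x, y)

theorem dx_periodic {φ : ℝ × ℝ → ℝ} (hφ : ∀ x y, φ (x + 1, y) = φ (x, y)) (x y : ℝ) :
    dx φ (x + 1, y) = dx φ (x, y) := by
  have h := deriv_comp_add_const (fun t => φ (t, y)) 1 x
  simp only [hφ] at h
  exact h.symm

/-! ### Integration over the domain -/

theorem measurableSet_Omega {h : ℝ → ℝ} (hc : Continuous h) : MeasurableSet (Omega h) := by
  have e : Omega h = regionBetween 0 h (Set.Icc 0 1) := by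
    ext p; simp [Omega, regionBetween, and_assoc]
  rw [e]
  exact measurableSet_regionBetween measurable_const hc.measurable measurableSet_Icc

theorem integrable_area {h : ℝ → ℝ} {H : ℝ} (hH : ∀ x, h x ≤ H) {F : ℝ × ℝ → ℝ}
    (hF : Continuous F) : Integrable F (area h) := by
  have hK : IsCompact (Set.Icc (0 : ℝ) 1 ×ˢ Set.Icc 0 H) := isCompact_Icc.prod isCompact_Icc
  refine (hF.continuousOn.integrableOn_compact hK).mono_set ?_
  rintro p ⟨h1, h2, h3, h4⟩
  exact ⟨⟨h1, h2⟩, h3.le, h4.le.trans (hH _)⟩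

theorem memLp_area {h : ℝ → ℝ} {H : ℝ} (hH : ∀ x, h x ≤ H) {F : ℝ × ℝ → ℝ}
    (hF : Continuous F) : MemLp F 2 (area h) :=
  (memLp_two_iff_integrable_sq hF.aestronglyMeasurable).2 (integrable_area hH (by fun_prop))

theorem integral_indicator_slice {h : ℝ → ℝ} (hpos : ∀ x, 0 < h x) (F : ℝ × ℝ → ℝ) (x : ℝ) :
    ∫ y, (Omega h).indicator F (x, y) =
      (Set.Icc 0 1).indicator (fun x => ∫ y in (0 : ℝ)..h x, F (x, y)) x := by
  by_cases hx : x ∈ Set.Icc (0 : ℝ) 1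
  · rw [Set.indicator_of_mem hx, intervalIntegral.integral_of_le (hpos x).le,
      integral_Ioc_eq_integral_Ioo, ← integral_indicator measurableSet_Ioo]
    congr 1; ext y
    by_cases hy : y ∈ Set.Ioo 0 (h x)
    · rw [Set.indicator_of_mem hy, Set.indicator_of_mem (show (x, y) ∈ Omega h from
        ⟨hx.1, hx.2, hy.1, hy.2⟩)]
    · rw [Set.indicator_of_notMem hy, Set.indicator_of_notMem (show (x, y) ∉ Omega h from
        fun hp => hy ⟨hp.2.2.1, hp.2.2.2⟩)]
  · rw [Set.indicator_of_notMem hx]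
    simp_rw [Set.indicator_of_notMem (show (x, _) ∉ Omega h from fun hp => hx ⟨hp.1, hp.2.1⟩)]
    simp

theorem integral_area_eq {h : ℝ → ℝ} (hc : Continuous h) (hpos : ∀ x, 0 < h x) {H : ℝ}
    (hH : ∀ x, h x ≤ H) {F : ℝ × ℝ → ℝ} (hF : Continuous F) :
    IntegrableOn (fun x => ∫ y in (0 : ℝ)..h x, F (x, y)) (Set.Icc 0 1) ∧
      ∫ p, F p ∂area h = ∫ x in Set.Icc (0 : ℝ) 1, ∫ y in (0 : ℝ)..h x, F (x, y) := by
  have hi : Integrable ((Omega h).indicator F) (volume.prod volume) :=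
    (integrable_indicator_iff (measurableSet_Omega hc)).2 (integrable_area hH hF)
  have h1 := hi.integral_prod_left
  have h2 := integral_prod _ hi
  simp_rw [integral_indicator_slice hpos F] at h1 h2
  refine ⟨(integrable_indicator_iff measurableSet_Icc).1 h1, ?_⟩
  rw [integral_indicator measurableSet_Icc] at h2
  rw [← h2]
  exact (integral_indicator (measurableSet_Omega hc)).symm

/-- Inequalities between integrals over vertical sections integrate to the domain. -/
theorem integral_area_le_of_slices {h : ℝ → ℝ} (hc : Continuous h) (hpos : ∀ x, 0 < h x) {H : ℝ}
    (hH : ∀ x, h x ≤ H) {F G : ℝ × ℝ → ℝ} (hF : Continuous F) (hG : Continuous G)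
    (hle : ∀ x, ∫ y in (0 : ℝ)..h x, F (x, y) ≤ ∫ y in (0 : ℝ)..h x, G (x, y)) :
    ∫ p, F p ∂area h ≤ ∫ p, G p ∂area h := by
  obtain ⟨h1, e1⟩ := integral_area_eq hc hpos hH hF
  obtain ⟨h2, e2⟩ := integral_area_eq hc hpos hH hG
  rw [e1, e2]
  exact setIntegral_mono h1 h2 hle

theorem poincare_bottom {h : ℝ → ℝ} (hc : Continuous h) (hpos : ∀ x, 0 < h x) {H : ℝ}
    (hH : ∀ x, h x ≤ H) {f f' : ℝ × ℝ → ℝ} (hf : Continuous f) (hf' : Continuous f')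
    (hd : ∀ x y, HasDerivAt (fun t => f (x, t)) (f' (x, y)) y) :
    ∫ p, (f p - f (p.1, 0)) ^ 2 ∂area h ≤ H ^ 2 / 2 * ∫ p, f' p ^ 2 ∂area h := by
  rw [← integral_const_mul]
  refine integral_area_le_of_slices hc hpos hH (by fun_prop) (by fun_prop) fun x => ?_
  rw [intervalIntegral.integral_const_mul]
  refine (integral_sq_sub_zero_le (hd x) (by fun_prop) (hpos x).le).trans ?_
  refine mul_le_mul_of_nonneg_right ?_ (intervalIntegral.integral_nonneg (hpos x).le
    fun _ _ => sq_nonneg _)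
  have := pow_le_pow_left₀ (hpos x).le (hH x) 2
  linarith

theorem poincare_bottom_second {h : ℝ → ℝ} (hc : Continuous h) (hpos : ∀ x, 0 < h x) {H : ℝ}
    (hH : ∀ x, h x ≤ H) {f f' f'' : ℝ × ℝ → ℝ} (hf : Continuous f) (hf' : Continuous f')
    (hf'' : Continuous f'')
    (hd : ∀ x y, HasDerivAt (fun t => f (x, t)) (f' (x, y)) y)
    (hd' : ∀ x y, HasDerivAt (fun t => f' (x, t)) (f'' (x, y)) y) :
    ∫ p, (f p - (f (p.1, 0) + p.2 * f' (p.1, 0))) ^ 2 ∂area h ≤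
      H ^ 4 / 12 * ∫ p, f'' p ^ 2 ∂area h := by
  rw [← integral_const_mul]
  refine integral_area_le_of_slices hc hpos hH (by fun_prop) (by fun_prop) fun x => ?_
  rw [intervalIntegral.integral_const_mul]
  refine (integral_sq_sub_taylor_le (hd x) (hd' x) (by fun_prop) (hpos x).le).trans ?_
  refine mul_le_mul_of_nonneg_right ?_ (intervalIntegral.integral_nonneg (hpos x).le
    fun _ _ => sq_nonneg _)
  have := pow_le_pow_left₀ (hpos x).le (hH x) 4
  linarith

/-- Trace inequality on the lower boundary. -/
theorem trace_bottom_le {h : ℝ → ℝ} (hc : Continuous h) {m H : ℝ} (hm : 0 < m)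
    (hmh : ∀ x, m ≤ h x) (hH : ∀ x, h x ≤ H) {f f' : ℝ × ℝ → ℝ} (hf : Continuous f)
    (hf' : Continuous f') (hd : ∀ x y, HasDerivAt (fun t => f (x, t)) (f' (x, y)) y) :
    m * ∫ x in Set.Icc (0 : ℝ) 1, f (x, 0) ^ 2 ≤
      2 * (∫ p, f p ^ 2 ∂area h) + H ^ 2 * ∫ p, f' p ^ 2 ∂area h := by
  have hpos : ∀ x, 0 < h x := fun x => hm.trans_le (hmh x)
  obtain ⟨h1, e1⟩ := integral_area_eq hc hpos hH (F := fun p => f p ^ 2) (by fun_prop)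
  obtain ⟨h2, e2⟩ := integral_area_eq hc hpos hH (F := fun p => f' p ^ 2) (by fun_prop)
  rw [e1, e2, ← integral_const_mul, ← integral_const_mul, ← integral_const_mul,
    ← integral_add (h1.const_mul _) (h2.const_mul _)]
  refine setIntegral_mono (Continuous.integrableOn_Icc (by fun_prop))
    ((h1.const_mul _).add (h2.const_mul _)) fun x => ?_
  have k1 := mul_sq_zero_le (hd x) (by fun_prop) (hpos x).le
  have k2 : h x ^ 2 * (∫ y in (0 : ℝ)..h x, f' (x, y) ^ 2) ≤
      H ^ 2 * ∫ y in (0 : ℝ)..h x, f' (x, y) ^ 2 :=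
    mul_le_mul_of_nonneg_right (pow_le_pow_left₀ (hpos x).le (hH x) 2)
      (intervalIntegral.integral_nonneg (hpos x).le fun _ _ => sq_nonneg _)
  have k3 := mul_le_mul_of_nonneg_right (hmh x) (sq_nonneg (f (x, 0)))
  simp only
  linarith

/-- The square integral over the domain of a function of `x` alone. -/
theorem integral_area_comp_fst_le {h : ℝ → ℝ} (hc : Continuous h) (hpos : ∀ x, 0 < h x) {H : ℝ}
    (hH : ∀ x, h x ≤ H) {u : ℝ → ℝ} (hu : Continuous u) :
    ∫ p, u p.1 ^ 2 ∂area h ≤ H * ∫ x in Set.Icc (0 : ℝ) 1, u x ^ 2 := by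
  obtain ⟨h1, e1⟩ := integral_area_eq hc hpos hH (F := fun p => u p.1 ^ 2) (by fun_prop)
  rw [e1, ← integral_const_mul]
  refine setIntegral_mono h1 (Continuous.integrableOn_Icc (by fun_prop)) fun x => ?_
  simp only [intervalIntegral.integral_const, smul_eq_mul, sub_zero]
  exact mul_le_mul_of_nonneg_right (hH x) (sq_nonneg _)

/-! ### Square integrals as norms -/

theorem norm_sq_eq_integral {α : Type*} [MeasurableSpace α] {μ : Measure α} (f : Lp ℝ 2 μ) :
    ‖f‖ ^ 2 = ∫ p, f p ^ 2 ∂μ := by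
  rw [← real_inner_self_eq_norm_sq, L2.inner_def]
  congr 1; ext p; simp [sq]

theorem norm_sq_eq_integral_of_ae {α : Type*} [MeasurableSpace α] {μ : Measure α} {f : Lp ℝ 2 μ}
    {F : α → ℝ} (hF : (f : α → ℝ) =ᵐ[μ] F) : ‖f‖ ^ 2 = ∫ p, F p ^ 2 ∂μ := by
  rw [norm_sq_eq_integral]
  exact integral_congr_ae (hF.mono fun p hp => by simp only [hp])

theorem norm_sub_sq_eq_integral_of_ae {α : Type*} [MeasurableSpace α] {μ : Measure α}
    {f g : Lp ℝ 2 μ} {F G : α → ℝ} (hF : (f : α → ℝ) =ᵐ[μ] F) (hG : (g : α → ℝ) =ᵐ[μ] G) :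
    ‖f - g‖ ^ 2 = ∫ p, (F p - G p) ^ 2 ∂μ := by
  refine norm_sq_eq_integral_of_ae ((Lp.coeFn_sub f g).trans ?_)
  filter_upwards [hF, hG] with p h1 h2
  simp [h1, h2]

/-- A bound `∫ (Fₙ - Rₙ)² ≤ C ∫ Gₙ²` passes to the `L²` limits when `Rₙ → 0`. -/
theorem integral_sq_le_of_tendsto {α : Type*} [MeasurableSpace α] {μ : Measure α}
    {J K : ℕ → Lp ℝ 2 μ} {j k : Lp ℝ 2 μ} {F G R : ℕ → α → ℝ} {C : ℝ}
    (hJ : Filter.Tendsto J Filter.atTop (nhds j)) (hK : Filter.Tendsto K Filter.atTop (nhds k))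
    (hJF : ∀ n, (J n : α → ℝ) =ᵐ[μ] F n) (hKG : ∀ n, (K n : α → ℝ) =ᵐ[μ] G n)
    (hR : ∀ n, MemLp (R n) 2 μ)
    (hR0 : Filter.Tendsto (fun n => ∫ p, R n p ^ 2 ∂μ) Filter.atTop (nhds 0))
    (hle : ∀ n, ∫ p, (F n p - R n p) ^ 2 ∂μ ≤ C * ∫ p, G n p ^ 2 ∂μ) :
    ∫ p, j p ^ 2 ∂μ ≤ C * ∫ p, k p ^ 2 ∂μ := by
  have e : ∀ n, ‖(hR n).toLp (R n)‖ ^ 2 = ∫ p, R n p ^ 2 ∂μ :=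
    fun n => norm_sq_eq_integral_of_ae (hR n).coeFn_toLp
  have hR1 : Filter.Tendsto (fun n => (hR n).toLp (R n)) Filter.atTop (nhds 0) := by
    rw [tendsto_zero_iff_norm_tendsto_zero]
    have := hR0.sqrt
    simp_rw [← e, Real.sqrt_zero, Real.sqrt_sq (norm_nonneg _)] at this
    exact this
  have h1 := ((hJ.sub hR1).norm.pow 2)
  have h2 := ((hK.norm.pow 2).const_mul C)
  rw [sub_zero] at h1
  rw [← norm_sq_eq_integral, ← norm_sq_eq_integral]
  refine le_of_tendsto_of_tendsto' h1 h2 fun n => ?_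
  rw [norm_sub_sq_eq_integral_of_ae (hJF n) (hR n).coeFn_toLp, norm_sq_eq_integral_of_ae (hKG n)]
  refine le_trans (le_of_eq (integral_congr_ae ?_)) (hle n)
  rfl

/-! ### Approximating sequences and lower traces -/

/-- Makes the product topology on jets first countable, so that points of a closure are limits of
sequences. -/
theorem countable_D2 : Countable D2 := by
  let f : D2 → ℕ
    | .o => 0 | .x => 1 | .y => 2 | .xx => 3 | .xy => 4 | .yy => 5
  refine Function.Injective.countable (f := f) ?_
  rintro (_ | _ | _ | _ | _ | _) (_ | _ | _ | _ | _ | _) hab <;> simp [f] at hab ⊢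

theorem HasTrace.exists_seq {h : ℝ → ℝ} {τ : (ℝ × ℝ → ℝ) → ℝ → ℝ} {ψ : H2 h}
    (hψ : HasTrace h τ ψ 0) : ∃ (φ : ℕ → ℝ × ℝ → ℝ) (J : ℕ → Jet h),
      (∀ n, IsC2Periodic (φ n)) ∧ (∀ n, IsJetOf h (J n) (φ n)) ∧
      (∀ i, Filter.Tendsto (fun n => J n i) Filter.atTop (nhds ((ψ : Jet h) i))) ∧
      Filter.Tendsto (fun n => ∫ x in Set.Icc (0 : ℝ) 1, τ (φ n) x ^ 2) Filter.atTop (nhds 0) := by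
  have := countable_D2
  obtain ⟨q, hq, hlim⟩ := mem_closure_iff_seq_limit.1 hψ
  choose φ h1 h2 h3 using hq
  have hl := (Prod.tendsto_iff _ _).1 hlim
  refine ⟨φ, fun n => (q n).1, h1, h2, tendsto_pi_nhds.1 hl.1, ?_⟩
  have h4 := hl.2.norm.pow 2
  simp only [norm_zero, ne_eq, OfNat.ofNat_ne_zero, not_false_eq_true, zero_pow] at h4
  exact h4.congr fun n => norm_sq_eq_integral_of_ae (h3 n)

/-- `i'` labels the `y`-derivative of the partial derivative labelled `i`. -/
def IsDyLabel (i i' : D2) : Prop :=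
  ∀ φ, IsC2Periodic φ → ∀ x y,
    HasDerivAt (fun t => partialD φ i (x, t)) (partialD φ i' (x, y)) y

theorem isDyLabel_o : IsDyLabel .o .y := fun _ hφ x y =>
  hasDerivAt_dy' (hφ.1.differentiable (by norm_num)) x y

theorem isDyLabel_y : IsDyLabel .y .yy := fun _ hφ x y =>
  hasDerivAt_dy' ((contDiff_dy (m := 1) hφ.1 (by norm_num)).differentiable (by norm_num)) x y

/-- The label `xy` stands for `dx (dy φ)`, so symmetry of second derivatives is needed here. -/
theorem isDyLabel_x : IsDyLabel .x .xy := fun φ hφ x y => by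
  have h := hasDerivAt_dy'
    ((contDiff_dx (m := 1) hφ.1 (by norm_num)).differentiable (by norm_num)) x y
  rw [dy_dx_eq hφ.1] at h
  exact h

theorem norm_sub_sq_le {E : Type*} [SeminormedAddCommGroup E] (a b c : E) :
    ‖a - b‖ ^ 2 ≤ 2 * ‖a - c‖ ^ 2 + 2 * ‖b - c‖ ^ 2 := by
  have h := norm_sub_le (a - c) (b - c)
  rw [sub_sub_sub_cancel_right] at h
  nlinarith [norm_nonneg (a - b), sq_nonneg (‖a - c‖ - ‖b - c‖)]

/-- The lower traces of two approximations of the same `H²` function are close. -/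
theorem trace_sub_le {h : ℝ → ℝ} (hc : Continuous h) {m H : ℝ} (hm : 0 < m)
    (hmh : ∀ x, m ≤ h x) (hH : ∀ x, h x ≤ H) {i i' : D2} (hi : IsDyLabel i i')
    {φ χ : ℝ × ℝ → ℝ} {J K : Jet h} (hφ : IsC2Periodic φ) (hχ : IsC2Periodic χ)
    (hJ : IsJetOf h J φ) (hK : IsJetOf h K χ) (ψ : Jet h) :
    ∫ x in Set.Icc (0 : ℝ) 1, (partialD φ i (x, 0) - partialD χ i (x, 0)) ^ 2 ≤
      m⁻¹ * (4 * ‖J i - ψ i‖ ^ 2 + 2 * H ^ 2 * ‖J i' - ψ i'‖ ^ 2) +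
      m⁻¹ * (4 * ‖K i - ψ i‖ ^ 2 + 2 * H ^ 2 * ‖K i' - ψ i'‖ ^ 2) := by
  have h1 := trace_bottom_le hc hm hmh hH
    (f := fun p => partialD φ i p - partialD χ i p)
    (f' := fun p => partialD φ i' p - partialD χ i' p)
    ((hφ.continuous_partialD i).sub (hχ.continuous_partialD i))
    ((hφ.continuous_partialD i').sub (hχ.continuous_partialD i'))
    fun x y => (hi φ hφ x y).sub (hi χ hχ x y)
  rw [← norm_sub_sq_eq_integral_of_ae (hJ i) (hK i),
    ← norm_sub_sq_eq_integral_of_ae (hJ i') (hK i')] at h1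
  -- Passing through the common limit `ψ` splits the bound into one error per approximant, the form
  -- `r n + r m` required by `tendsto_integral_sq_deriv_zero`.
  have h2 := norm_sub_sq_le (J i) (K i) (ψ i)
  have h3 := mul_le_mul_of_nonneg_left (norm_sub_sq_le (J i') (K i') (ψ i')) (sq_nonneg H)
  rw [← mul_add, ← div_eq_inv_mul, le_div_iff₀ hm]
  linarith

theorem tendsto_trace_error {h : ℝ → ℝ} {J : ℕ → Jet h} {ψ : Jet h}
    (hJ : ∀ i, Filter.Tendsto (fun n => J n i) Filter.atTop (nhds (ψ i))) (m H : ℝ) (i i' : D2) :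
    Filter.Tendsto (fun n => m⁻¹ * (4 * ‖J n i - ψ i‖ ^ 2 + 2 * H ^ 2 * ‖J n i' - ψ i'‖ ^ 2))
      Filter.atTop (nhds 0) := by
  have h0 : ∀ i, Filter.Tendsto (fun n => ‖J n i - ψ i‖ ^ 2) Filter.atTop (nhds 0) := fun i => by
    simpa using ((hJ i).sub_const (ψ i)).norm.pow 2
  simpa using (((h0 i).const_mul 4).add ((h0 i').const_mul (2 * H ^ 2))).const_mul m⁻¹

/-- The vanishing of a lower trace does not depend on the approximating sequence. -/
theorem tendsto_trace_of_tendsto_trace {h : ℝ → ℝ} (hc : Continuous h) {m H : ℝ} (hm : 0 < m)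
    (hmh : ∀ x, m ≤ h x) (hH : ∀ x, h x ≤ H) {i i' : D2} (hi : IsDyLabel i i')
    {φ χ : ℕ → ℝ × ℝ → ℝ} {J K : ℕ → Jet h} {ψ : Jet h} (hφ : ∀ n, IsC2Periodic (φ n))
    (hχ : ∀ n, IsC2Periodic (χ n)) (hJ : ∀ n, IsJetOf h (J n) (φ n))
    (hK : ∀ n, IsJetOf h (K n) (χ n))
    (hJl : ∀ i, Filter.Tendsto (fun n => J n i) Filter.atTop (nhds (ψ i)))
    (hKl : ∀ i, Filter.Tendsto (fun n => K n i) Filter.atTop (nhds (ψ i)))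
    (hT : Filter.Tendsto (fun n => ∫ x in Set.Icc (0 : ℝ) 1, partialD (χ n) i (x, 0) ^ 2)
      Filter.atTop (nhds 0)) :
    Filter.Tendsto (fun n => ∫ x in Set.Icc (0 : ℝ) 1, partialD (φ n) i (x, 0) ^ 2)
      Filter.atTop (nhds 0) := by
  -- The majorant comes from `a² ≤ 2(a - b)² + 2b²`, with `a` and `b` the traces of `φ n` and `χ n`.
  have hl := (((tendsto_trace_error hJl m H i i').add
    (tendsto_trace_error hKl m H i i')).const_mul 2).add (hT.const_mul 2)
  simp only [add_zero, mul_zero] at hl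
  refine squeeze_zero (fun n => integral_nonneg fun _ => sq_nonneg _) (fun n => ?_) hl
  refine le_trans ?_ (add_le_add_left (mul_le_mul_of_nonneg_left
    (trace_sub_le hc hm hmh hH hi (hφ n) (hχ n) (hJ n) (hK n) ψ) zero_le_two) _)
  have c1 := (hφ n).continuous_partialD i
  have c2 := (hχ n).continuous_partialD i
  rw [← integral_const_mul, ← integral_const_mul, ← integral_add]
  · refine setIntegral_mono (Continuous.integrableOn_Icc (by fun_prop))
      (Continuous.integrableOn_Icc (by fun_prop)) fun x => ?_
    simp only
    nlinarith [sq_nonneg (partialD (φ n) i (x, 0) - 2 * partialD (χ n) i (x, 0))]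
  all_goals exact Continuous.integrableOn_Icc (by fun_prop)

theorem integral_Icc_eq_intervalIntegral (f : ℝ → ℝ) :
    ∫ x in Set.Icc (0 : ℝ) 1, f x = ∫ x in (0 : ℝ)..1, f x := by
  rw [intervalIntegral.integral_of_le zero_le_one, integral_Icc_eq_integral_Ioc]

/-- If the lower trace of `ψ` vanishes then so does that of its tangential derivative. -/
theorem tendsto_trace_dx {h : ℝ → ℝ} (hc : Continuous h) {m H : ℝ} (hm : 0 < m)
    (hmh : ∀ x, m ≤ h x) (hH : ∀ x, h x ≤ H)
    {φ : ℕ → ℝ × ℝ → ℝ} {J : ℕ → Jet h} {ψ : Jet h} (hφ : ∀ n, IsC2Periodic (φ n))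
    (hJ : ∀ n, IsJetOf h (J n) (φ n))
    (hJl : ∀ i, Filter.Tendsto (fun n => J n i) Filter.atTop (nhds (ψ i)))
    (hT : Filter.Tendsto (fun n => ∫ x in Set.Icc (0 : ℝ) 1, φ n (x, 0) ^ 2)
      Filter.atTop (nhds 0)) :
    Filter.Tendsto (fun n => ∫ x in Set.Icc (0 : ℝ) 1, dx (φ n) (x, 0) ^ 2)
      Filter.atTop (nhds 0) := by
  simp_rw [integral_Icc_eq_intervalIntegral] at hT ⊢
  refine tendsto_integral_sq_deriv_zero (g'' := fun n x => dx (dx (φ n)) (x, 0))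
    (fun n x => hasDerivAt_dx' ((hφ n).1.differentiable (by norm_num)) x 0)
    (fun n x => hasDerivAt_dx' ((contDiff_dx (m := 1) (hφ n).1
      (by norm_num)).differentiable (by norm_num)) x 0)
    (fun n => ((hφ n).continuous_partialD .xx).comp (by fun_prop))
    (fun n => by simpa using (hφ n).2 0 0)
    (fun n => by simpa using dx_periodic (hφ n).2 0 0) hT
    (tendsto_trace_error hJl m H .x .xy) fun n k => ?_
  rw [← integral_Icc_eq_intervalIntegral]
  exact trace_sub_le hc hm hmh hH isDyLabel_x (hφ n) (hφ k) (hJ n) (hJ k) ψ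

/-! ### Poincaré inequalities in `H²` and coercivity -/

/-- The Poincaré inequality for a partial derivative whose lower trace vanishes. -/
theorem integral_wD_sq_le {h : ℝ → ℝ} (hc : Continuous h) (hpos : ∀ x, 0 < h x) {H : ℝ}
    (hH : ∀ x, h x ≤ H) {i i' : D2} (hi : IsDyLabel i i') {φ : ℕ → ℝ × ℝ → ℝ} {J : ℕ → Jet h}
    {ψ : H2 h} (hφ : ∀ n, IsC2Periodic (φ n)) (hJ : ∀ n, IsJetOf h (J n) (φ n))
    (hJl : ∀ i, Filter.Tendsto (fun n => J n i) Filter.atTop (nhds ((ψ : Jet h) i)))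
    (hT : Filter.Tendsto (fun n => ∫ x in Set.Icc (0 : ℝ) 1, partialD (φ n) i (x, 0) ^ 2)
      Filter.atTop (nhds 0)) :
    ∫ p, wD ψ i p ^ 2 ∂area h ≤ H ^ 2 / 2 * ∫ p, wD ψ i' p ^ 2 ∂area h := by
  have c := fun n => (hφ n).continuous_partialD i
  refine integral_sq_le_of_tendsto (hJl i) (hJl i') (fun n => hJ n i) (fun n => hJ n i')
    -- The correction is the lower trace extended constantly in `y`; its squared norm over the
    -- domain is at most `H` times that of the trace.
    (R := fun n p => partialD (φ n) i (p.1, 0))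
    (fun n => memLp_area hH ((c n).comp (by fun_prop))) ?_
    fun n => poincare_bottom hc hpos hH (c n) ((hφ n).continuous_partialD i') (hi _ (hφ n))
  refine squeeze_zero (fun n => integral_nonneg fun _ => sq_nonneg _) (fun n => ?_)
    (by simpa using hT.const_mul H)
  exact integral_area_comp_fst_le hc hpos hH (u := fun x => partialD (φ n) i (x, 0))
    ((c n).comp (by fun_prop))

/-- The second order Poincaré inequality, for vanishing lower traces of `ψ` and `ψ_y`. -/
theorem norm0Sq_le {h : ℝ → ℝ} (hc : Continuous h) (hpos : ∀ x, 0 < h x) {H : ℝ}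
    (hH : ∀ x, h x ≤ H) {φ : ℕ → ℝ × ℝ → ℝ} {J : ℕ → Jet h}
    {ψ : H2 h} (hφ : ∀ n, IsC2Periodic (φ n)) (hJ : ∀ n, IsJetOf h (J n) (φ n))
    (hJl : ∀ i, Filter.Tendsto (fun n => J n i) Filter.atTop (nhds ((ψ : Jet h) i)))
    (hT : Filter.Tendsto (fun n => ∫ x in Set.Icc (0 : ℝ) 1, φ n (x, 0) ^ 2)
      Filter.atTop (nhds 0))
    (hT' : Filter.Tendsto (fun n => ∫ x in Set.Icc (0 : ℝ) 1, dy (φ n) (x, 0) ^ 2)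
      Filter.atTop (nhds 0)) :
    norm0Sq ψ ≤ H ^ 4 / 12 * ∫ p, wD ψ .yy p ^ 2 ∂area h := by
  have c := fun n => (hφ n).continuous_partialD .o
  have c' := fun n => (hφ n).continuous_partialD .y
  have b : ∀ n, Continuous fun x : ℝ => φ n (x, 0) := fun n => (c n).comp (by fun_prop)
  have b' : ∀ n, Continuous fun x : ℝ => dy (φ n) (x, 0) := fun n => (c' n).comp (by fun_prop)
  refine integral_sq_le_of_tendsto (hJl .o) (hJl .yy) (fun n => hJ n .o) (fun n => hJ n .yy)
    -- The correction is the first-order Taylor polynomial in `y` at the lower boundary. It tends to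
    -- zero because both traces do and `0 < y < H` on the domain.
    (R := fun n p => φ n (p.1, 0) + p.2 * dy (φ n) (p.1, 0))
    (fun n => memLp_area hH (((b n).comp continuous_fst).add
      (continuous_snd.mul ((b' n).comp continuous_fst)))) ?_
    fun n => poincare_bottom_second hc hpos hH (c n) (c' n) ((hφ n).continuous_partialD .yy)
      (isDyLabel_o _ (hφ n)) (isDyLabel_y _ (hφ n))
  have hl := ((hT.const_mul H).const_mul 2).add ((hT'.const_mul H).const_mul (2 * H ^ 2))
  simp only [mul_zero, add_zero] at hl
  refine squeeze_zero (fun n => integral_nonneg fun _ => sq_nonneg _) (fun n => ?_) hl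
  have k1 := integral_area_comp_fst_le hc hpos hH (b n)
  have k2 := integral_area_comp_fst_le hc hpos hH (b' n)
  have i1 : Integrable (fun p : ℝ × ℝ => φ n (p.1, 0) ^ 2) (area h) :=
    integrable_area hH (((b n).comp continuous_fst).pow 2)
  have i2 : Integrable (fun p : ℝ × ℝ => dy (φ n) (p.1, 0) ^ 2) (area h) :=
    integrable_area hH (((b' n).comp continuous_fst).pow 2)
  have k3 : ∫ p, (φ n (p.1, 0) + p.2 * dy (φ n) (p.1, 0)) ^ 2 ∂area h ≤
      ∫ p, (2 * φ n (p.1, 0) ^ 2 + 2 * H ^ 2 * dy (φ n) (p.1, 0) ^ 2) ∂area h := by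
    refine setIntegral_mono_on (integrable_area hH ((((b n).comp continuous_fst).add
      (continuous_snd.mul ((b' n).comp continuous_fst))).pow 2))
      ((i1.const_mul 2).add (i2.const_mul (2 * H ^ 2))) (measurableSet_Omega hc) fun p hp => ?_
    have k := mul_le_mul_of_nonneg_right
      (pow_le_pow_left₀ hp.2.2.1.le (hp.2.2.2.le.trans (hH p.1)) 2)
      (sq_nonneg (dy (φ n) (p.1, 0)))
    nlinarith [sq_nonneg (φ n (p.1, 0) - p.2 * dy (φ n) (p.1, 0))]
  rw [integral_add (i1.const_mul 2) (i2.const_mul (2 * H ^ 2)), integral_const_mul,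
    integral_const_mul] at k3
  have k4 := mul_le_mul_of_nonneg_left k2 (by positivity : 0 ≤ 2 * H ^ 2)
  linarith

theorem integrable_wD_sq {h : ℝ → ℝ} (ψ : H2 h) (i : D2) :
    Integrable (fun p => wD ψ i p ^ 2) (area h) :=
  (Lp.memLp ((ψ : Jet h) i)).integrable_sq

theorem aForm_self {h : ℝ → ℝ} (ε : ℝ) (ψ : H2 h) :
    aForm ε ψ ψ = (∫ p, wD ψ .yy p ^ 2 ∂area h) + 2 * ε ^ 2 * (∫ p, wD ψ .xy p ^ 2 ∂area h)
      + ε ^ 4 * ∫ p, wD ψ .xx p ^ 2 ∂area h := by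
  simp only [aForm, ← sq]
  have i1 := integrable_wD_sq ψ .yy
  have i2 := (integrable_wD_sq ψ .xy).const_mul (2 * ε ^ 2)
  have i3 := (integrable_wD_sq ψ .xx).const_mul (ε ^ 4)
  have i12 : Integrable (fun p => wD ψ .yy p ^ 2 + 2 * ε ^ 2 * wD ψ .xy p ^ 2) (area h) :=
    i1.add i2
  rw [integral_add i12 i3, integral_add i1 i2, integral_const_mul, integral_const_mul]

theorem seminorm1Sq_eq {h : ℝ → ℝ} (ε : ℝ) (ψ : H2 h) :
    seminorm1Sq ε ψ = (∫ p, wD ψ .y p ^ 2 ∂area h) + ε ^ 2 * ∫ p, wD ψ .x p ^ 2 ∂area h := by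
  simp only [seminorm1Sq, mul_pow]
  rw [integral_add (integrable_wD_sq ψ .y) ((integrable_wD_sq ψ .x).const_mul (ε ^ 2)),
    integral_const_mul]

/-- The quantitative coercivity estimate for a film of thickness at most `H`. -/
theorem weightedNorm2_sq_le {h : ℝ → ℝ} (hc : Continuous h) {m H : ℝ} (hm : 0 < m)
    (hmh : ∀ x, m ≤ h x) (hH : ∀ x, h x ≤ H) (ε : ℝ) {ψ : H2 h} (hψ : ψ ∈ Psi h) :
    weightedNorm2 ε ψ ^ 2 ≤ (1 + H ^ 2 / 2 + H ^ 4 / 12) * aForm ε ψ ψ := by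
  have hpos : ∀ x, 0 < h x := fun x => hm.trans_le (hmh x)
  obtain ⟨φ, J, hφ, hJ, hJl, hT⟩ := hψ.1.exists_seq
  obtain ⟨χ, K, hχ, hK, hKl, hT'⟩ := hψ.2.1.exists_seq
  -- The two trace conditions supply different sequences; the vanishing of the `ψ_y` trace is
  -- carried from `χ` over to `φ`.
  have hTy := tendsto_trace_of_tendsto_trace hc hm hmh hH isDyLabel_y hφ hχ hJ hK hJl hKl hT'
  have hTx := tendsto_trace_dx hc hm hmh hH hφ hJ hJl hT
  have e0 := norm0Sq_le hc hpos hH hφ hJ hJl hT hTy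
  have ey := integral_wD_sq_le hc hpos hH isDyLabel_y hφ hJ hJl hTy
  have ex := integral_wD_sq_le hc hpos hH isDyLabel_x hφ hJ hJl hTx
  have nn : ∀ i, 0 ≤ ∫ p, wD ψ i p ^ 2 ∂area h := fun i => integral_nonneg fun _ => sq_nonneg _
  have n0 : 0 ≤ norm0Sq ψ := nn .o
  rw [weightedNorm2, Real.sq_sqrt, seminorm2Sq, seminorm1Sq_eq, aForm_self]
  · have a1 := mul_le_mul_of_nonneg_left ex (sq_nonneg ε)
    have a2 : 0 ≤ ε ^ 2 * ∫ p, wD ψ .xy p ^ 2 ∂area h := mul_nonneg (sq_nonneg ε) (nn .xy)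
    have a3 : 0 ≤ ε ^ 4 * ∫ p, wD ψ .xx p ^ 2 ∂area h := mul_nonneg (by positivity) (nn .xx)
    -- These products are the surplus terms on the right: the constant multiplies all of `a_ε`,
    -- whereas the Poincaré bounds use only part of it.
    have a4 := mul_nonneg (by positivity : 0 ≤ H ^ 2 / 2) a2
    have a5 := mul_nonneg (by positivity : 0 ≤ H ^ 4 / 12) a2
    have a6 := mul_nonneg (by positivity : 0 ≤ H ^ 2 / 2) a3
    have a7 := mul_nonneg (by positivity : 0 ≤ H ^ 4 / 12) a3
    linarith
  · rw [seminorm2Sq, seminorm1Sq_eq, aForm_self]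
    have := nn .y; have := nn .x; have := nn .xx; have := nn .xy; have := nn .yy
    positivity

/-- Compactness of one period. The positive lower bound feeds the trace inequality but does not
enter the final constant. -/
theorem exists_bounds_of_periodic {h : ℝ → ℝ} (hc : Continuous h) (hper : ∀ x, h (x + 1) = h x)
    (hpos : ∀ x, 0 < h x) : ∃ m H : ℝ, 0 < m ∧ (∀ x, m ≤ h x) ∧ ∀ x, h x ≤ H := by
  have hP : Function.Periodic h 1 := hper
  obtain ⟨a, -, ha⟩ := isCompact_Icc.exists_isMinOn (s := Set.Icc (0 : ℝ) 1) ⟨0, by simp⟩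
    hc.continuousOn
  obtain ⟨b, -, hb⟩ := isCompact_Icc.exists_isMaxOn (s := Set.Icc (0 : ℝ) 1) ⟨0, by simp⟩
    hc.continuousOn
  have key : ∀ x, ∃ y ∈ Set.Icc (0 : ℝ) 1, h x = h y := fun x => by
    obtain ⟨y, hy, e⟩ := hP.exists_mem_Ico₀ zero_lt_one x
    exact ⟨y, Set.Ico_subset_Icc_self hy, e⟩
  refine ⟨h a, h b, hpos a, fun x => ?_, fun x => ?_⟩ <;> obtain ⟨y, hy, e⟩ := key x <;> rw [e]
  · exact ha hy
  · exact hb hy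

end Lubrication

theorem mainTheorem5 (h : ℝ → ℝ) (hreg : Lubrication.IsC11Periodic h) (hpos : ∀ x, 0 < h x) :
    (∃ α : ℝ, 0 < α ∧ ∀ ε : ℝ, 0 < ε → ∀ ψ ∈ Lubrication.Psi h,
      α * Lubrication.weightedNorm2 ε ψ ^ 2 ≤ Lubrication.aForm ε ψ ψ) ∧
    ((∀ x, h x ≤ 1) → ∀ ε : ℝ, 0 < ε → ∀ ψ ∈ Lubrication.Psi h,
      (12 / 19 : ℝ) * Lubrication.weightedNorm2 ε ψ ^ 2 ≤ Lubrication.aForm ε ψ ψ) := by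
  have hc : Continuous h := hreg.2.1.continuous
  obtain ⟨m, H, hm, hmh, hH⟩ := Lubrication.exists_bounds_of_periodic hc hreg.1 hpos
  refine ⟨⟨(1 + H ^ 2 / 2 + H ^ 4 / 12)⁻¹, by positivity, fun ε _ ψ hψ => ?_⟩,
    fun h1 ε _ ψ hψ => ?_⟩
  · rw [inv_mul_le_iff₀ (by positivity)]
    exact Lubrication.weightedNorm2_sq_le hc hm hmh hH ε hψ
  -- With thickness bound `1` the factor is `1 + 1/2 + 1/12 = 19/12`.
  · have := Lubrication.weightedNorm2_sq_le hc hm hmh h1 ε hψ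
    linarith
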